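/- Let $S^1=\mathbb R/2\pi\mathbb Z$ with coordinate $s$ and $D_s=\partial/\partial s$, and let $$\mathcal M=\{\gamma:S^1\to\mathbb R^2\setminus\{0\}\ \text{smooth}\mid \det(\gamma,\gamma_s)=1\}$$ be the space of closed equicentroaffine plane curves. The equicentroaffine curvature $\kappa:S^1\to\mathbb R$ of $\gamma\in\mathcal M$ is defined by $\gamma_{ss}=-\kappa\gamma$. The tangent space $T_\gamma\mathcal M$ consists of the motion vector fields $\gamma_t|_{t=0}$ of smooth one-parameter families $\gamma(\cdot,t)\in\mathcal M$ with $\gamma(\cdot,0)=\gamma$. The form $\omega_1$ and the function $H_1$ on $\mathcal M$ are given by $$\omega_1(X,Y)=\int_{S^1}\det\bigl(X,\,(D_s^2+\kappa)Y\bigr)\,ds\quad(X,Y\in T_\gamma\mathcal M),\qquad H_1(\gamma)=\int_{S^1}\kappa\,ds .$$ Let $S^1$ act on $\mathcal M$ by $\gamma\mapsto\gamma(\cdot+\sigma)$, $\sigma\in S^1$. For $a\in\mathrm{Lie}(S^1)$ let $\underline a_\gamma=\frac{d}{d\tau}\big|_{\tau=0}\exp(\tau a)\cdot\gamma$ be the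 fundamental vector field. A moment map for this action with respect to $\omega_1$ is a smooth $S^1$-invariant map $\mu:\mathcal M\to\mathrm{Lie}(S^1)^*$ with $d\langle\mu,a\rangle=\omega_1(\underline a,\,\cdot\,)$ on every $T_\gamma\mathcal M$ for every $a\in\mathrm{Lie}(S^1)$ (smoothness and differentials being tested along smooth one-parameter families in $\mathcal M$). **Theorem.** The $S^1$-action on $\mathcal M$ leaves $\omega_1$ invariant and is Hamiltonian with respect to $\omega_1$, that is, it has a moment map. A moment map $\mu_1$ is given by $$\mu_1(\gamma)\Bigl(\frac{\partial}{\partial\sigma}\Bigr)=H_1(\gamma)=\int_{S^1}\kappa\,ds,\qquad \gamma\in\mathcal M .$$ -/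

import Mathlib

noncomputable section

namespace EquicentroaffineKdV

/-- The circle `ℝ / 2πℤ`. Its `volume` is the arc-length measure `ds`, of total mass `2π`. -/
abbrev S1 : Type := AddCircle (2 * Real.pi)

instance instFactTwoPiPos : Fact (0 < 2 * Real.pi) := ⟨Real.two_pi_pos⟩

/-- Vectors of the plane `ℝ²`, written as rows. -/
abbrev Plane : Type := Fin 2 → ℝ

/-- The determinant of the `2 × 2` matrix with rows `v` and `w`. -/
def det (v w : Plane) : ℝ := (Matrix.of ![v, w]).det

/-- The derivative `D_s f` of a function on the circle:
`(D_s f)(x) = d/dh f (x + h)` at `h = 0`. -/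
def Ds (f : S1 → Plane) : S1 → Plane :=
  fun x => deriv (fun h : ℝ => f (x + (h : S1))) 0

/-- The space `M` of closed equicentroaffine plane curves: smooth maps `γ : S¹ → ℝ²` with
`det (γ, γ_s) = 1`. (The curve then automatically avoids the origin.) -/
@[ext]
structure M where
  toFun : S1 → Plane
  smooth' : ContDiff ℝ (⊤ : ℕ∞) (fun s : ℝ => toFun (s : S1))
  det_eq_one' : ∀ x : S1, det (toFun x) (Ds toFun x) = 1

instance instCoeFunM : CoeFun M (fun _ => S1 → Plane) := ⟨M.toFun⟩

theorem M.ne_zero (γ : M) (x : S1) : γ x ≠ 0 := by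
  intro h
  have h1 := γ.det_eq_one' x
  simp [det, h, Matrix.det_fin_two] at h1

theorem Ds_shift (f : S1 → Plane) (σ x : S1) :
    Ds (fun y => f (y + σ)) x = Ds f (x + σ) := by
  simp only [Ds, add_right_comm]

/-- The action of `S¹` on `M` by `(σ, γ) ↦ γ(· + σ)`. -/
instance instAddActionM : AddAction S1 M where
  vadd σ γ :=
    { toFun := fun x => γ (x + σ)
      smooth' := by
        induction σ using QuotientAddGroup.induction_on with
        | H r => exact γ.smooth'.comp (contDiff_id.add (contDiff_const (c := r)))
      det_eq_one' := fun x => by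
        rw [Ds_shift]
        exact γ.det_eq_one' (x + σ) }
  zero_vadd γ := M.ext (funext fun x => congrArg γ.toFun (add_zero x))
  add_vadd σ τ γ := M.ext (funext fun x => congrArg γ.toFun (by
    change x + (σ + τ) = x + σ + τ
    rw [add_assoc]))

/-- The equicentroaffine curvature `κ` of `γ`, the function with `γ_ss = -κ γ`
(see `Ds_Ds_eq_neg_curvature_smul` and `curvature_unique`). -/
def curvature (γ : M) (x : S1) : ℝ := det (Ds γ x) (Ds (Ds γ) x)

theorem Ds_coe (f : S1 → Plane) (s : ℝ) :
    Ds f (s : S1) = deriv (fun r : ℝ => f (r : S1)) s := by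
  have h := deriv_comp_const_add (f := fun r : ℝ => f (r : S1)) s 0
  simpa [Ds] using h

theorem contDiff_Ds {f : S1 → Plane} (hf : ContDiff ℝ (⊤ : ℕ∞) (fun s : ℝ => f (s : S1))) :
    ContDiff ℝ (⊤ : ℕ∞) (fun s : ℝ => Ds f (s : S1)) := by
  simp only [Ds_coe]
  exact (contDiff_infty_iff_deriv.1 hf).2

theorem Ds_Ds_eq_neg_curvature_smul (γ : M) (x : S1) :
    Ds (Ds γ) x = -(curvature γ x) • γ x := by
  induction x using QuotientAddGroup.induction_on with
  | H s =>
    set g : ℝ → Plane := fun r => γ (r : S1) with hg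
    set g1 : ℝ → Plane := fun r => Ds γ (r : S1) with hg1
    have d0 : HasDerivAt g (g1 s) s := by
      rw [hg1]
      simp only [Ds_coe]
      exact (γ.smooth'.differentiable (by simp) s).hasDerivAt
    have d1 : HasDerivAt g1 (Ds (Ds γ) (s : S1)) s := by
      rw [Ds_coe (Ds γ)]
      exact ((contDiff_Ds γ.smooth').differentiable (by simp) s).hasDerivAt
    have hdet : ∀ r : ℝ, g r 0 * g1 r 1 - g r 1 * g1 r 0 = 1 := fun r => by
      have := γ.det_eq_one' (r : S1)
      simpa [det, Matrix.det_fin_two] using this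
    have a := hasDerivAt_pi.1 d0
    have b := hasDerivAt_pi.1 d1
    have c := ((a 0).mul (b 1)).sub ((a 1).mul (b 0))
    have c' := c.congr_of_eventuallyEq (f₁ := fun _ => (1 : ℝ))
      (Filter.Eventually.of_forall fun r => (hdet r).symm)
    have e := c'.unique (hasDerivAt_const s (1 : ℝ))
    have k : curvature γ (s : S1) =
        g1 s 0 * Ds (Ds γ) (s : S1) 1 - g1 s 1 * Ds (Ds γ) (s : S1) 0 := by
      simp [curvature, det, Matrix.det_fin_two, hg1]
    have hd := hdet s
    change Ds (Ds γ) (s : S1) = -(curvature γ (s : S1)) • g s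
    rw [k]
    generalize Ds (Ds γ) (s : S1) = w at *
    ext i
    fin_cases i
    · simp
      linear_combination (-w 0) * hd + g1 s 0 * e
    · simp
      linear_combination (-w 1) * hd + g1 s 1 * e

theorem curvature_unique (γ : M) (x : S1) (k : ℝ) (h : Ds (Ds γ) x = -k • γ x) :
    k = curvature γ x := by
  rw [Ds_Ds_eq_neg_curvature_smul] at h
  have := smul_left_injective ℝ (γ.ne_zero x) h
  simpa using this.symm

/-- The total curvature `H₁(γ) = ∫ κ ds`. -/
def H1 (γ : M) : ℝ := ∫ x : S1, curvature γ x

/-- `ω₁(X, Y) = ∫ det (X, (D_s² + κ) Y) ds` at the curve `γ`. -/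
def omega1 (γ : M) (X Y : S1 → Plane) : ℝ :=
  ∫ x : S1, det (X x) (Ds (Ds Y) x + curvature γ x • Y x)

/-- Smooth one-parameter families `γ(·, t)`, `t ∈ ℝ`, of curves in `M`: smooth in `(t, s)` jointly. -/
def IsSmoothFamily (c : ℝ → M) : Prop :=
  ContDiff ℝ (⊤ : ℕ∞) (fun p : ℝ × ℝ => c p.1 (p.2 : S1))

/-- The motion vector field `γ_t` of a one-parameter family at `t = 0`. -/
def velocity (c : ℝ → M) : S1 → Plane := fun x => deriv (fun t : ℝ => c t x) 0

/-- The tangent space `T_γ M`: the motion vector fields at `γ` of smooth one-parameter families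
in `M` through `γ`. -/
def tangentSpace (γ : M) : Set (S1 → Plane) :=
  {X | ∃ c : ℝ → M, IsSmoothFamily c ∧ c 0 = γ ∧ velocity c = X}

/-- Covariant 2-tensors on `M`: `ω γ X Y` is meaningful for `X, Y ∈ T_γ M`. -/
abbrev TwoTensor : Type := M → (S1 → Plane) → (S1 → Plane) → ℝ

/-- The circle action leaves `ω` invariant: the pull-back of `ω` by each `γ ↦ γ(· + σ)` is `ω`.
The differential of this map sends the velocity of `c` to the velocity of `t ↦ c(t)(· + σ)`. -/
def IsInvariant (ω : TwoTensor) : Prop :=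
  ∀ (σ : S1) (γ : M) (c₁ c₂ : ℝ → M), IsSmoothFamily c₁ → IsSmoothFamily c₂ →
    c₁ 0 = γ → c₂ 0 = γ →
    ω (σ +ᵥ γ) (velocity fun t => σ +ᵥ c₁ t) (velocity fun t => σ +ᵥ c₂ t) =
      ω γ (velocity c₁) (velocity c₂)

/-- The Lie algebra of `S¹ = ℝ / 2πℤ`, with exponential map `a ↦ a mod 2π`. -/
abbrev LieS1 : Type := ℝ

/-- The generator `∂/∂σ` of the Lie algebra of `S¹`. -/
def ddσ : LieS1 := 1

/-- The fundamental vector field on `M` of `a ∈ Lie(S¹)`: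
the velocity at `τ = 0` of `exp(τ a) · γ`. -/
def fundamentalField (a : LieS1) (γ : M) : S1 → Plane :=
  velocity fun τ : ℝ => ((τ * a : ℝ) : S1) +ᵥ γ

/-- A function on `M` is smooth if it is smooth along all smooth one-parameter families. -/
def IsSmoothFunction (F : M → ℝ) : Prop :=
  ∀ c : ℝ → M, IsSmoothFamily c → ContDiff ℝ (⊤ : ℕ∞) (fun t => F (c t))

/-- `(dF)_γ (X) = L X` for all `X ∈ T_γ M`: the derivative of `F` along every smooth family
through `γ` with velocity `X` is `L X`. -/
def IsDifferentialAt (F : M → ℝ) (γ : M) (L : (S1 → Plane) → ℝ) : Prop :=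
  ∀ X ∈ tangentSpace γ, ∀ c : ℝ → M, IsSmoothFamily c → c 0 = γ → velocity c = X →
    HasDerivAt (fun t => F (c t)) (L X) 0

/-- `μ : M → Lie(S¹)*` is a moment map of the circle action with respect to `ω`. The coadjoint
action of `S¹` is trivial, so that equivariance means invariance. -/
structure IsMomentMap (ω : TwoTensor) (μ : M → Module.Dual ℝ LieS1) : Prop where
  smooth : ∀ a : LieS1, IsSmoothFunction fun γ => μ γ a
  differential : ∀ (a : LieS1) (γ : M),
    fundamentalField a γ ∈ tangentSpace γ ∧
      IsDifferentialAt (fun η => μ η a) γ (fun X => ω γ (fundamentalField a γ) X)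
  equivariant : ∀ (σ : S1) (γ : M), μ (σ +ᵥ γ) = μ γ

/-- The circle action on `M` is Hamiltonian with respect to `ω`:
it leaves `ω` invariant and has a moment map. -/
def IsHamiltonianAction (ω : TwoTensor) : Prop :=
  IsInvariant ω ∧ ∃ μ : M → Module.Dual ℝ LieS1, IsMomentMap ω μ

end EquicentroaffineKdV

end

/-!
The moment map identity already holds for the integrands. Let `γ(·, t)` be a smooth family in `M`
with velocity `X` at `t = 0`. Differentiating `κ = det (γ_s, γ_ss)` and interchanging `∂_t` with
`∂_s` gives `κ_t = det (X_s, γ_ss) + det (γ_s, X_ss)`. Since `γ_ss = -κ γ`, the first term is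
`κ det (γ, X_s)`, and differentiating the constraint `det (γ, γ_s) = 1` in `t` turns this into
`κ det (γ_s, X)`. Hence `κ_t = det (γ_s, (D_s² + κ) X)` (`hasDerivAt_curvature`), with no
integration by parts. Integrating over the circle gives `dH₁ (X) = ω₁ (γ_s, X)`
(`hasDerivAt_H1`), and the fundamental field of `a` is `a γ_s` (`fundamentalField_eq`), so
`μ(γ)(a) = a H₁(γ)` is a moment map.

Smoothness of `t ↦ H₁(γ(·, t))` is repeated differentiation under the integral sign
(`contDiff_intervalIntegral`). Invariance of `ω₁` and of `H₁` is the translation invariance of the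
measure `ds`, because `D_s` and `κ` commute with the shifts of the circle.
-/

open MeasureTheory

namespace EquicentroaffineKdV

/-! ### Partial derivatives of smooth functions on the plane of parameters -/

section Partial

variable {E : Type*} [NormedAddCommGroup E] [NormedSpace ℝ E]

/-- The derivative of `F` along the constant vector field `v`. The parameter plane has coordinates
`(t, s)`, so that `v = (1, 0)` gives `∂_t` and `v = (0, 1)` gives `∂_s`. -/
noncomputable def dirDeriv (v : ℝ × ℝ) (F : ℝ × ℝ → E) (p : ℝ × ℝ) : E := fderiv ℝ F p v

theorem contDiff_dirDeriv {F : ℝ × ℝ → E} (hF : ContDiff ℝ (⊤ : ℕ∞) F) (v : ℝ × ℝ) :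
    ContDiff ℝ (⊤ : ℕ∞) (dirDeriv v F) :=
  (hF.fderiv_right (m := (⊤ : ℕ∞)) (by simp)).clm_apply contDiff_const

theorem hasDerivAt_fst_slice {F : ℝ × ℝ → E} (hF : ContDiff ℝ (⊤ : ℕ∞) F) (t s : ℝ) :
    HasDerivAt (fun r => F (r, s)) (dirDeriv (1, 0) F (t, s)) t :=
  ((hF.differentiable (by simp)) (t, s)).hasFDerivAt.comp_hasDerivAt t
    ((hasDerivAt_id t).prodMk (hasDerivAt_const t s))

theorem hasDerivAt_snd_slice {F : ℝ × ℝ → E} (hF : ContDiff ℝ (⊤ : ℕ∞) F) (t s : ℝ) :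
    HasDerivAt (fun r => F (t, r)) (dirDeriv (0, 1) F (t, s)) s :=
  ((hF.differentiable (by simp)) (t, s)).hasFDerivAt.comp_hasDerivAt s
    ((hasDerivAt_const s t).prodMk (hasDerivAt_id s))

theorem dirDeriv_comm {F : ℝ × ℝ → E} (hF : ContDiff ℝ (⊤ : ℕ∞) F) (v w : ℝ × ℝ) :
    dirDeriv v (dirDeriv w F) = dirDeriv w (dirDeriv v F) := by
  funext p
  have hd : DifferentiableAt ℝ (fderiv ℝ F) p :=
    (hF.fderiv_right (m := (⊤ : ℕ∞)) (by simp)).differentiable (by simp) p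
  have key : ∀ u u' : ℝ × ℝ, dirDeriv u (dirDeriv u' F) p = fderiv ℝ (fderiv ℝ F) p u u' := by
    intro u u'
    have h := (hd.hasFDerivAt.clm_apply (hasFDerivAt_const u' p)).fderiv
    change fderiv ℝ (fun q => fderiv ℝ F q u') p u = _
    rw [h]
    simp
  rw [key, key]
  exact (hF.contDiffAt (x := p)).isSymmSndFDerivAt
    (by simp only [minSmoothness_of_isRCLikeNormedField]; exact WithTop.coe_le_coe.2 le_top) v w

theorem hasDerivAt_intervalIntegral {F : ℝ × ℝ → E} (hF : ContDiff ℝ (⊤ : ℕ∞) F) (a b t : ℝ) :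
    HasDerivAt (fun r => ∫ s in a..b, F (r, s)) (∫ s in a..b, dirDeriv (1, 0) F (t, s)) t := by
  have hF' := contDiff_dirDeriv hF (1, 0)
  -- The derivative is bounded on a compact rectangle, which provides the dominating constant.
  obtain ⟨C, hC⟩ := ((isCompact_closedBall t 1).prod (isCompact_uIcc (a := a) (b := b))
    ).exists_bound_of_continuousOn hF'.continuous.continuousOn
  refine (intervalIntegral.hasDerivAt_integral_of_dominated_loc_of_deriv_le
    (F := fun r s => F (r, s)) (F' := fun r s => dirDeriv (1, 0) F (r, s)) (bound := fun _ => C)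
    (Metric.closedBall_mem_nhds t one_pos) ?_ ?_ ?_ ?_ ?_ ?_).2
  · exact Filter.Eventually.of_forall fun r =>
      (hF.continuous.comp (Continuous.prodMk_right r)).aestronglyMeasurable
  · exact (hF.continuous.comp (Continuous.prodMk_right t)).intervalIntegrable a b
  · exact (hF'.continuous.comp (Continuous.prodMk_right t)).aestronglyMeasurable
  · exact Filter.Eventually.of_forall fun s hs r hr => hC (r, s) ⟨hr, Set.uIoc_subset_uIcc hs⟩
  · exact intervalIntegrable_const
  · exact Filter.Eventually.of_forall fun s _ r _ => hasDerivAt_fst_slice hF r s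

theorem contDiff_intervalIntegral {F : ℝ × ℝ → E} (hF : ContDiff ℝ (⊤ : ℕ∞) F) (a b : ℝ) :
    ContDiff ℝ (⊤ : ℕ∞) (fun t => ∫ s in a..b, F (t, s)) := by
  refine contDiff_infty.2 fun n => ?_
  induction n generalizing F with
  | zero =>
    exact contDiff_zero.2 (continuous_iff_continuousAt.2 fun t =>
      (hasDerivAt_intervalIntegral hF a b t).continuousAt)
  | succ n ih =>
    push_cast
    refine contDiff_succ_iff_deriv.2
      ⟨fun t => (hasDerivAt_intervalIntegral hF a b t).differentiableAt, by simp, ?_⟩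
    rw [funext fun t => (hasDerivAt_intervalIntegral hF a b t).deriv]
    exact ih (contDiff_dirDeriv hF (1, 0))

end Partial

/-! ### The determinant -/

theorem det_eq (v w : Plane) : det v w = v 0 * w 1 - v 1 * w 0 := by
  simp [det, Matrix.det_fin_two]

theorem det_smul_left (a : ℝ) (v w : Plane) : det (a • v) w = a * det v w := by
  simp only [det_eq, Pi.smul_apply, smul_eq_mul]
  ring

theorem hasDerivAt_det {f g : ℝ → Plane} {f' g' : Plane} {t : ℝ} (hf : HasDerivAt f f' t)
    (hg : HasDerivAt g g' t) :
    HasDerivAt (fun r => det (f r) (g r)) (det f' (g t) + det (f t) g') t := by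
  have a := hasDerivAt_pi.1 hf
  have b := hasDerivAt_pi.1 hg
  simp only [det_eq]
  exact (((a 0).mul (b 1)).sub ((a 1).mul (b 0))).congr_deriv (by ring)

theorem contDiff_det {F G : ℝ × ℝ → Plane} (hF : ContDiff ℝ (⊤ : ℕ∞) F)
    (hG : ContDiff ℝ (⊤ : ℕ∞) G) : ContDiff ℝ (⊤ : ℕ∞) (fun p => det (F p) (G p)) := by
  simp only [det_eq]
  have a := contDiff_pi.1 hF
  have b := contDiff_pi.1 hG
  exact ((a 0).mul (b 1)).sub ((a 1).mul (b 0))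

/-! ### Smooth families of curves -/

/-- The lift `(t, s) ↦ γ(s, t)` of a one-parameter family of closed curves to the plane of
parameters. -/
noncomputable def familyLift (c : ℝ → M) (p : ℝ × ℝ) : Plane := c p.1 (p.2 : S1)

/-- `D_s` is the second partial derivative, for every function on the circle that lifts to a slice
of a smooth function. -/
theorem Ds_eq_dirDeriv {F : ℝ × ℝ → Plane} (hF : ContDiff ℝ (⊤ : ℕ∞) F) {f : S1 → Plane} {t : ℝ}
    (hf : ∀ s : ℝ, f (s : S1) = F (t, s)) (s : ℝ) :
    Ds f (s : S1) = dirDeriv (0, 1) F (t, s) := by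
  rw [Ds_coe, funext hf]
  exact (hasDerivAt_snd_slice hF t s).deriv

theorem velocity_eq_dirDeriv {c : ℝ → M} (hc : IsSmoothFamily c) (s : ℝ) :
    velocity c (s : S1) = dirDeriv (1, 0) (familyLift c) (0, s) :=
  (hasDerivAt_fst_slice (F := familyLift c) hc 0 s).deriv

/-- The lift `(t, s) ↦ κ(s, t)` of the curvatures of a family of curves to the plane of
parameters. -/
noncomputable def curvatureLift (c : ℝ → M) (p : ℝ × ℝ) : ℝ := curvature (c p.1) (p.2 : S1)

theorem contDiff_curvatureLift {c : ℝ → M} (hc : IsSmoothFamily c) :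
    ContDiff ℝ (⊤ : ℕ∞) (curvatureLift c) := by
  have hG : ContDiff ℝ (⊤ : ℕ∞) (familyLift c) := hc
  have h1 := contDiff_dirDeriv hG (0, 1)
  have h2 := contDiff_dirDeriv h1 (0, 1)
  convert contDiff_det h1 h2 using 2 with p
  have e1 := Ds_eq_dirDeriv hG (f := c p.1) (t := p.1) fun _ => rfl
  have e2 := Ds_eq_dirDeriv h1 e1
  rw [curvatureLift, curvature, e1, e2]

/-- The first variation of the curvature: `κ_t = det (γ_s, (D_s² + κ) X)`. -/
theorem hasDerivAt_curvature {c : ℝ → M} (hc : IsSmoothFamily c) (x : S1) :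
    HasDerivAt (fun t => curvature (c t) x)
      (det (Ds (c 0) x) (Ds (Ds (velocity c)) x + curvature (c 0) x • velocity c x)) 0 := by
  induction x using QuotientAddGroup.induction_on with
  | H s =>
    have hG : ContDiff ℝ (⊤ : ℕ∞) (familyLift c) := hc
    have hGs := contDiff_dirDeriv hG (0, 1)
    have hGss := contDiff_dirDeriv hGs (0, 1)
    have hGt := contDiff_dirDeriv hG (1, 0)
    have hGts := contDiff_dirDeriv hGt (0, 1)
    have e1 := fun t => Ds_eq_dirDeriv hG (f := c t) (t := t) fun _ => rfl
    have e2 := fun t => Ds_eq_dirDeriv hGs (e1 t)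
    have v0 := velocity_eq_dirDeriv hc
    have v1 := Ds_eq_dirDeriv hGt v0
    have v2 := Ds_eq_dirDeriv hGts v1
    have dG := hasDerivAt_fst_slice hG 0 s
    have dGs := hasDerivAt_fst_slice hGs 0 s
    have dGss := hasDerivAt_fst_slice hGss 0 s
    rw [dirDeriv_comm hG (1, 0)] at dGs
    rw [dirDeriv_comm hGs (1, 0), dirDeriv_comm hG (1, 0)] at dGss
    have constraint : det (dirDeriv (1, 0) (familyLift c) (0, s))
        (dirDeriv (0, 1) (familyLift c) (0, s)) + det (familyLift c (0, s))
          (dirDeriv (0, 1) (dirDeriv (1, 0) (familyLift c)) (0, s)) = 0 := by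
      refine (hasDerivAt_det dG dGs).unique ?_
      convert hasDerivAt_const (0 : ℝ) (1 : ℝ) using 2 with t
      rw [← e1]
      exact (c t).det_eq_one' s
    have structureEq : dirDeriv (0, 1) (dirDeriv (0, 1) (familyLift c)) (0, s) =
        -(curvature (c 0) (s : S1)) • familyLift c (0, s) := by
      rw [← e2]
      exact Ds_Ds_eq_neg_curvature_smul (c 0) s
    have hK := hasDerivAt_det dGs dGss
    have hfun : (fun t => curvature (c t) (s : S1)) = fun t =>
        det (dirDeriv (0, 1) (familyLift c) (t, s))
          (dirDeriv (0, 1) (dirDeriv (0, 1) (familyLift c)) (t, s)) := by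
      funext t
      rw [curvature, e1, e2]
    change HasDerivAt (fun t => curvature (c t) (s : S1)) (det (Ds (c 0) (s : S1))
      (Ds (Ds (velocity c)) (s : S1) + curvature (c 0) (s : S1) • velocity c (s : S1))) 0
    rw [hfun, v2, v0, e1]
    convert hK using 1
    rw [structureEq]
    simp only [det_eq, Pi.add_apply, Pi.smul_apply, smul_eq_mul] at constraint ⊢
    linear_combination (-curvature (c 0) (s : S1)) * constraint

/-! ### The first variation of the total curvature -/

theorem H1_eq_intervalIntegral (c : ℝ → M) (t : ℝ) :
    H1 (c t) = ∫ s in (0 : ℝ)..0 + 2 * Real.pi, curvatureLift c (t, s) :=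
  (AddCircle.intervalIntegral_preimage (2 * Real.pi) 0 (curvature (c t))).symm

theorem isSmoothFunction_H1 : IsSmoothFunction H1 := fun c hc => by
  simp only [H1_eq_intervalIntegral c]
  exact contDiff_intervalIntegral (contDiff_curvatureLift hc) _ _

/-- The differential of the total curvature is `X ↦ ω₁ (γ_s, X)`. -/
theorem hasDerivAt_H1 {c : ℝ → M} (hc : IsSmoothFamily c) :
    HasDerivAt (fun t => H1 (c t)) (omega1 (c 0) (Ds (c 0)) (velocity c)) 0 := by
  have hK := contDiff_curvatureLift hc
  have h := hasDerivAt_intervalIntegral hK 0 (0 + 2 * Real.pi) 0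
  simp only [← H1_eq_intervalIntegral c] at h
  refine h.congr_deriv (Eq.symm ?_)
  rw [omega1, ← AddCircle.intervalIntegral_preimage (2 * Real.pi) 0]
  exact intervalIntegral.integral_congr fun s _ =>
    (hasDerivAt_curvature hc (s : S1)).unique (hasDerivAt_fst_slice hK 0 s)

/-! ### The circle action -/

theorem curvature_vadd (σ : S1) (γ : M) (x : S1) :
    curvature (σ +ᵥ γ) x = curvature γ (x + σ) := by
  have h : Ds (σ +ᵥ γ).toFun = fun y => Ds γ (y + σ) := funext fun y => Ds_shift γ σ y
  simp only [curvature, h, Ds_shift]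

theorem H1_vadd (σ : S1) (γ : M) : H1 (σ +ᵥ γ) = H1 γ := by
  simp only [H1, curvature_vadd]
  exact integral_add_right_eq_self (curvature γ) σ

theorem isInvariant_omega1 : IsInvariant omega1 := by
  intro σ γ c₁ c₂ _ _ _ _
  have h : ∀ c : ℝ → M, velocity (fun t => σ +ᵥ c t) = fun x => velocity c (x + σ) := fun _ => rfl
  have hDs : Ds (fun y => velocity c₂ (y + σ)) = fun y => Ds (velocity c₂) (y + σ) :=
    funext fun y => Ds_shift _ σ y
  simp only [omega1, h, hDs, Ds_shift, curvature_vadd]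
  exact integral_add_right_eq_self
    (fun x => det (velocity c₁ x) (Ds (Ds (velocity c₂)) x + curvature γ x • velocity c₂ x)) σ

theorem isSmoothFamily_orbit (a : LieS1) (γ : M) :
    IsSmoothFamily fun τ : ℝ => ((τ * a : ℝ) : S1) +ᵥ γ :=
  γ.smooth'.comp (contDiff_snd.add (contDiff_fst.mul contDiff_const))

theorem fundamentalField_mem_tangentSpace (a : LieS1) (γ : M) :
    fundamentalField a γ ∈ tangentSpace γ := by
  refine ⟨_, isSmoothFamily_orbit a γ, ?_, rfl⟩
  simp

theorem fundamentalField_eq (a : LieS1) (γ : M) : fundamentalField a γ = a • Ds γ := by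
  funext x
  induction x using QuotientAddGroup.induction_on with
  | H s =>
    have d : HasDerivAt (fun r : ℝ => γ (r : S1)) (Ds γ (s : S1)) (s + 0 * a) := by
      rw [Ds_coe, zero_mul, add_zero]
      exact (γ.smooth'.differentiable (by simp) s).hasDerivAt
    have e : HasDerivAt (fun τ : ℝ => s + τ * a) a 0 := by
      simpa using ((hasDerivAt_id (0 : ℝ)).mul_const a).const_add s
    exact (d.scomp (0 : ℝ) e).deriv

theorem omega1_smul_left (a : ℝ) (γ : M) (X Y : S1 → Plane) :
    omega1 γ (a • X) Y = a * omega1 γ X Y := by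
  simp only [omega1, Pi.smul_apply, det_smul_left]
  exact integral_const_mul a _

/-! ### The moment map -/

/-- The moment map `μ₁`: the linear form `a ↦ a H₁(γ)` on the Lie algebra, whose value at `∂/∂σ`
is `H₁(γ)`. -/
noncomputable def totalCurvatureMomentMap (γ : M) : Module.Dual ℝ LieS1 :=
  H1 γ • LinearMap.id

theorem totalCurvatureMomentMap_apply (γ : M) (a : LieS1) :
    totalCurvatureMomentMap γ a = a * H1 γ :=
  mul_comm (H1 γ) a

theorem isMomentMap_totalCurvatureMomentMap : IsMomentMap omega1 totalCurvatureMomentMap where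
  smooth a c hc := by
    simp only [totalCurvatureMomentMap_apply]
    exact contDiff_const.mul (isSmoothFunction_H1 c hc)
  differential a γ := by
    refine ⟨fundamentalField_mem_tangentSpace a γ, ?_⟩
    rintro X - c hc rfl rfl
    simp only [totalCurvatureMomentMap_apply, fundamentalField_eq, omega1_smul_left]
    exact (hasDerivAt_H1 hc).const_mul a
  equivariant σ γ := by
    rw [totalCurvatureMomentMap, H1_vadd, totalCurvatureMomentMap]

end EquicentroaffineKdV

open EquicentroaffineKdV in
theorem theorem2p3 :
    IsInvariant omega1 ∧ IsHamiltonianAction omega1 ∧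
      ∃ μ₁ : M → Module.Dual ℝ LieS1,
        IsMomentMap omega1 μ₁ ∧ ∀ γ : M, μ₁ γ ddσ = H1 γ :=
  ⟨isInvariant_omega1, ⟨isInvariant_omega1, _, isMomentMap_totalCurvatureMomentMap⟩,
    totalCurvatureMomentMap, isMomentMap_totalCurvatureMomentMap, fun γ => by
      rw [totalCurvatureMomentMap_apply, ddσ, one_mul]⟩
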